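/- Let $n$ be a positive integer, and let $c\colon E(K_{6n})\to\{1,2,3\}$ be a (not necessarily proper) edge-coloring of the complete graph $K_{6n}$ on $6n$ vertices such that there are equally many edges of each of the three colors. Then $K_{6n}$ has a perfect matching $M$ with $$\sum_{i=1}^{3}\bigl|\,|c^{-1}(i)\cap M|-n\,\bigr|\le 2,$$ where $|c^{-1}(i)\cap M|$ is the number of edges of $M$ that have color $i$. -/

import Mathlib

namespace ColorBalanced

/-- The number of edges of color `i` under the (not necessarily proper) edge-coloring `c` of the
complete graph on `V` with `k` colors. -/
noncomputable def numColor {V : Type*} {k : ℕ}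
    (c : SimpleGraph.TopEdgeLabeling V (Fin k)) (i : Fin k) : ℕ :=
  Set.ncard {e : (⊤ : SimpleGraph V).edgeSet | c e = i}

/-- The coloring is color-balanced: there are equally many edges of each color. -/
def IsColorBalanced {V : Type*} {k : ℕ}
    (c : SimpleGraph.TopEdgeLabeling V (Fin k)) : Prop :=
  ∀ i j : Fin k, numColor c i = numColor c j

/-- `m_i(M) = |c⁻¹(i) ∩ M|`: the number of edges of color `i` in the subgraph `M`. -/
noncomputable def numColorIn {V : Type*} {k : ℕ}
    (c : SimpleGraph.TopEdgeLabeling V (Fin k)) (M : (⊤ : SimpleGraph V).Subgraph)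
    (i : Fin k) : ℕ :=
  Set.ncard {e : (⊤ : SimpleGraph V).edgeSet | c e = i ∧ (e : Sym2 V) ∈ M.edgeSet}

/-- The total deviation `f(M) = ∑ i, |m_i(M) - n|`, an integer. -/
noncomputable def deviation {V : Type*} {k : ℕ}
    (c : SimpleGraph.TopEdgeLabeling V (Fin k)) (n : ℕ)
    (M : (⊤ : SimpleGraph V).Subgraph) : ℤ :=
  ∑ i : Fin k, |(numColorIn c M i : ℤ) - (n : ℤ)|

end ColorBalanced

namespace ColorBalanced

/-! The deviations of a matching from `n` in the three colors sum to zero. A switch trades two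
matching edges for two edges on the same four vertices. Averaged over all ordered pairs of vertices,
the change of the deviation vector is a negative multiple of that vector, because every color class
has the average size (`sum_gain`). Hence any linear functional positive at the deviation is
decreased by some switch (`exists_gain_neg`).

Take a matching whose largest absolute deviation `t` is minimal. If `t ≤ 1`, then the zero sum
bounds the total by 2. If `t ≥ 2`, every switch must still leave some deviation of size at least
`t`. Suitable functionals then rule out each possible shape up to permutation: first `(t - 1, 1,
-t)`, then two positive entries against `-t`, then `t` against two negative entries, and finally
`(t, 0, -t)`. The first and last shapes need two successive switches; the rest is bounded integer
arithmetic. -/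

/-- A perfect matching of the complete graph on `V`, as a fixed-point-free involution. -/
structure Pairing (V : Type*) where
  toFun : V → V
  invol : ∀ v, toFun (toFun v) = v
  ne : ∀ v, toFun v ≠ v

namespace Pairing

variable {V : Type*}

theorem injective (σ : Pairing V) : Function.Injective σ.toFun :=
  Function.LeftInverse.injective σ.invol

theorem eq_iff (σ : Pairing V) (u v : V) : σ.toFun u = v ↔ u = σ.toFun v :=
  ⟨fun h => by rw [← h, σ.invol], fun h => by rw [h, σ.invol]⟩

/-- The subgraph of the complete graph whose edges are the pairs `{v, σ v}`. -/
def subgraph (σ : Pairing V) : (⊤ : SimpleGraph V).Subgraph where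
  verts := Set.univ
  Adj u v := σ.toFun u = v
  adj_sub := by
    rintro u v rfl
    exact (σ.ne u).symm
  edge_vert _ := Set.mem_univ _
  symm := ⟨by
    rintro u v rfl
    exact σ.invol u⟩

theorem isPerfectMatching_subgraph (σ : Pairing V) : σ.subgraph.IsPerfectMatching := by
  rw [SimpleGraph.Subgraph.isPerfectMatching_iff]
  exact fun v => ⟨σ.toFun v, rfl, fun w hw => Eq.symm hw⟩

/-- Replace the pairs `{a, σ a}`, `{b, σ b}` by `{a, b}`, `{σ a, σ b}`. -/
def switch [DecidableEq V] (σ : Pairing V) (a b : V) (hab : b ≠ a) (hab' : b ≠ σ.toFun a) :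
    Pairing V where
  toFun v := if v = a then b else if v = b then a else if v = σ.toFun a then σ.toFun b
    else if v = σ.toFun b then σ.toFun a else σ.toFun v
  invol v := by
    have := σ.invol
    have := σ.ne
    have := σ.injective
    have := σ.eq_iff
    grind
  ne v := by
    have := σ.ne
    have := σ.injective
    have := σ.eq_iff
    grind

theorem switch_apply_of_ne [DecidableEq V] (σ : Pairing V) {a b : V} (hab : b ≠ a)
    (hab' : b ≠ σ.toFun a) {v : V} (h1 : v ≠ a) (h2 : v ≠ b) (h3 : v ≠ σ.toFun a) (h4 : v ≠ σ.toFun b) :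
    (σ.switch a b hab hab').toFun v = σ.toFun v := by
  simp [Pairing.switch, h1, h2, h3, h4]

end Pairing

/-! ### Counting colored edges, and the average effect of a switch -/

section Counting

variable {V : Type*}

/-- The color of the edge `uv` (and `0` if `u = v`). -/
noncomputable def edgeColor [DecidableEq V] (c : SimpleGraph.TopEdgeLabeling V (Fin 3)) (u v : V) :
    Fin 3 :=
  if h : u ≠ v then c ⟨s(u, v), h⟩ else 0

theorem edgeColor_comm [DecidableEq V] (c : SimpleGraph.TopEdgeLabeling V (Fin 3)) (u v : V) :
    edgeColor c u v = edgeColor c v u := by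
  unfold edgeColor
  by_cases h : u = v
  · simp [h]
  · simp [h, Ne.symm h, Sym2.eq_swap]

/-- The indicator of `x = l`. -/
def hit (x l : Fin 3) : ℤ := if x = l then 1 else 0

theorem hit_nonneg (x l : Fin 3) : 0 ≤ hit x l := by
  unfold hit; split_ifs <;> simp

theorem hit_eq_zero_or_one (x l : Fin 3) : hit x l = 0 ∨ hit x l = 1 := by
  unfold hit; split_ifs <;> simp

theorem eq_of_hit_pos {x l : Fin 3} (h : 0 < hit x l) : x = l := by
  by_contra hx
  simp [hit, hx] at h

theorem hit_self (x : Fin 3) : hit x x = 1 := by simp [hit]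

theorem hit_add_hit_add_hit {i j k : Fin 3} (hij : i ≠ j) (hjk : j ≠ k) (hik : i ≠ k) (x : Fin 3) :
    hit x i + hit x j + hit x k = 1 := by
  revert i j k x
  unfold hit
  decide

/-- Counting the ordered pairs `(u, v)` whose edge has color `l` and lies in a graph `H` counts
every such edge twice. -/
theorem sum_hit_of_adj [Fintype V] [DecidableEq V] (c : SimpleGraph.TopEdgeLabeling V (Fin 3))
    (l : Fin 3) (H : SimpleGraph V) [DecidableRel H.Adj] :
    ∑ u, ∑ v, (if H.Adj u v then hit (edgeColor c u v) l else 0) =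
      2 * (Set.ncard
        {e : (⊤ : SimpleGraph V).edgeSet | c e = l ∧ (e : Sym2 V) ∈ H.edgeSet} : ℤ) := by
  classical
  let G : SimpleGraph V :=
    { Adj := fun u v => H.Adj u v ∧ edgeColor c u v = l
      symm := ⟨fun u v h => ⟨h.1.symm, by rw [edgeColor_comm, h.2]⟩⟩
      loopless := ⟨fun u h => H.loopless.irrefl u h.1⟩ }
  have himage : Set.ncard {e : (⊤ : SimpleGraph V).edgeSet | c e = l ∧ (e : Sym2 V) ∈ H.edgeSet} =
      G.edgeFinset.card := by
    rw [← Set.ncard_image_of_injective _ Subtype.val_injective, ← Set.ncard_coe_finset]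
    congr 1
    ext e
    induction e with
    | _ u v =>
      simp only [Set.mem_image, Set.mem_ofPred_eq, Subtype.exists, SimpleGraph.coe_edgeFinset,
        SimpleGraph.mem_edgeSet, G]
      constructor
      · rintro ⟨e, he, ⟨h1, h2⟩, rfl⟩
        have hne : u ≠ v := he
        exact ⟨h2, by simpa [edgeColor, hne] using h1⟩
      · rintro ⟨h1, h2⟩
        have hne : u ≠ v := h1.ne
        exact ⟨s(u, v), hne, ⟨by simpa [edgeColor, hne] using h2, h1⟩, rfl⟩
  have hdeg := G.sum_degrees_eq_twice_card_edges
  rw [himage]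
  have : ((∑ v, G.degree v : ℕ) : ℤ) = 2 * (G.edgeFinset.card : ℤ) := by exact_mod_cast hdeg
  rw [← this, Nat.cast_sum]
  refine Finset.sum_congr rfl fun u _ => ?_
  rw [← SimpleGraph.card_neighborFinset_eq_degree, SimpleGraph.neighborFinset_eq_filter,
    Finset.card_filter, Nat.cast_sum]
  refine Finset.sum_congr rfl fun v _ => ?_
  by_cases h1 : H.Adj u v <;> by_cases h2 : edgeColor c u v = l <;> simp [G, hit, h1, h2]

theorem eq_of_hit_add_hit_eq_two {x y l : Fin 3} (h : hit x l + hit y l = 2) : x = l ∧ y = l := by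
  have hx := hit_eq_zero_or_one x l
  have hy := hit_eq_zero_or_one y l
  exact ⟨eq_of_hit_pos (by omega), eq_of_hit_pos (by omega)⟩

section Gain

variable [DecidableEq V]

/-- The signed deviation of color `l`. -/
noncomputable def dev (c : SimpleGraph.TopEdgeLabeling V (Fin 3)) (n : ℕ) (σ : Pairing V)
    (l : Fin 3) : ℤ :=
  numColorIn c σ.subgraph l - n

/-- The number of edges of color `l` that `Pairing.switch` adds. -/
noncomputable def added (c : SimpleGraph.TopEdgeLabeling V (Fin 3)) (σ : Pairing V) (a b : V)
    (l : Fin 3) : ℤ :=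
  hit (edgeColor c a b) l + hit (edgeColor c (σ.toFun a) (σ.toFun b)) l

/-- The number of edges of color `l` that `Pairing.switch` removes. -/
noncomputable def removed (c : SimpleGraph.TopEdgeLabeling V (Fin 3)) (σ : Pairing V) (a b : V)
    (l : Fin 3) : ℤ :=
  hit (edgeColor c a (σ.toFun a)) l + hit (edgeColor c b (σ.toFun b)) l

/-- The change of the number of edges of color `l` under `Pairing.switch`. -/
noncomputable def gain (c : SimpleGraph.TopEdgeLabeling V (Fin 3)) (σ : Pairing V) (a b : V)
    (l : Fin 3) : ℤ :=
  added c σ a b l - removed c σ a b l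

theorem gain_comm (c : SimpleGraph.TopEdgeLabeling V (Fin 3)) (σ : Pairing V) (a b : V)
    (l : Fin 3) : gain c σ a b l = gain c σ b a l := by
  rw [gain, gain, added, added, removed, removed, edgeColor_comm c a b,
    edgeColor_comm c (σ.toFun a) (σ.toFun b)]
  ring

/-- A gain depends only on the two pairs involved, so it survives an earlier switch performed
elsewhere. -/
theorem gain_congr (c : SimpleGraph.TopEdgeLabeling V (Fin 3)) {σ τ : Pairing V} {x p : V}
    (hx : τ.toFun x = σ.toFun x) (hp : τ.toFun p = σ.toFun p) (l : Fin 3) :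
    gain c τ x p l = gain c σ x p l := by
  simp only [gain, added, removed, hx, hp]

/-- The sign and sum constraints on the numbers of edges added and removed by a switch. -/
theorem added_removed_bounds (c : SimpleGraph.TopEdgeLabeling V (Fin 3)) (σ : Pairing V) (a b : V)
    {i j k : Fin 3} (hij : i ≠ j) (hjk : j ≠ k) (hik : i ≠ k) :
    (0 ≤ added c σ a b i ∧ 0 ≤ added c σ a b j ∧ 0 ≤ added c σ a b k ∧
      added c σ a b i + added c σ a b j + added c σ a b k = 2) ∧
    (0 ≤ removed c σ a b i ∧ 0 ≤ removed c σ a b j ∧ 0 ≤ removed c σ a b k ∧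
      removed c σ a b i + removed c σ a b j + removed c σ a b k = 2) := by
  have h0 := hit_nonneg
  have h1 := fun x => hit_add_hit_add_hit hij hjk hik x
  unfold added removed
  refine ⟨⟨add_nonneg (h0 _ _) (h0 _ _), add_nonneg (h0 _ _) (h0 _ _),
    add_nonneg (h0 _ _) (h0 _ _), ?_⟩, add_nonneg (h0 _ _) (h0 _ _), add_nonneg (h0 _ _) (h0 _ _),
    add_nonneg (h0 _ _) (h0 _ _), ?_⟩
  · linarith [h1 (edgeColor c a b), h1 (edgeColor c (σ.toFun a) (σ.toFun b))]
  · linarith [h1 (edgeColor c a (σ.toFun a)), h1 (edgeColor c b (σ.toFun b))]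

end Gain

variable [Fintype V] [DecidableEq V]

theorem sum_hit_numColor (c : SimpleGraph.TopEdgeLabeling V (Fin 3)) (l : Fin 3) :
    ∑ u, ∑ v, (if v ≠ u then hit (edgeColor c u v) l else 0) = 2 * (numColor c l : ℤ) := by
  have h := sum_hit_of_adj c l (⊤ : SimpleGraph V)
  have hset : {e : (⊤ : SimpleGraph V).edgeSet |
      c e = l ∧ (e : Sym2 V) ∈ (⊤ : SimpleGraph V).edgeSet}
      = {e : (⊤ : SimpleGraph V).edgeSet | c e = l} := by
    ext e
    simp only [Set.mem_ofPred_eq, e.2, and_true]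
  rw [hset] at h
  simpa only [SimpleGraph.top_adj, ne_comm, numColor] using h

theorem sum_hit_numColorIn (c : SimpleGraph.TopEdgeLabeling V (Fin 3)) (σ : Pairing V)
    (l : Fin 3) :
    ∑ v, hit (edgeColor c v (σ.toFun v)) l = 2 * (numColorIn c σ.subgraph l : ℤ) := by
  classical
  have h := sum_hit_of_adj c l σ.subgraph.spanningCoe
  rw [SimpleGraph.Subgraph.edgeSet_spanningCoe] at h
  rw [numColorIn, ← h]
  refine Finset.sum_congr rfl fun u _ => ?_
  have : ∀ v, (if σ.subgraph.spanningCoe.Adj u v then hit (edgeColor c u v) l else 0) =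
      if σ.toFun u = v then hit (edgeColor c u v) l else 0 := fun v => if_congr Iff.rfl rfl rfl
  rw [Finset.sum_congr rfl fun v _ => this v]
  simp

theorem dev_switch (c : SimpleGraph.TopEdgeLabeling V (Fin 3)) (n : ℕ) (σ : Pairing V) (a b : V)
    (hab : b ≠ a) (hab' : b ≠ σ.toFun a) (l : Fin 3) :
    dev c n (σ.switch a b hab hab') l = dev c n σ l + gain c σ a b l := by
  have h1 := sum_hit_numColorIn c σ l
  have h2 := sum_hit_numColorIn c (σ.switch a b hab hab') l
  have ha := σ.ne a
  have hb := σ.ne b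
  have hba : σ.toFun b ≠ a := fun h => hab' (by rw [← h, σ.invol])
  have hσ : σ.toFun a ≠ σ.toFun b := fun h => hab (σ.injective h).symm
  -- Only four vertices change partner, and each edge is seen from both its ends, whence the factor
  -- 2.
  have key : ∑ v, (hit (edgeColor c v ((σ.switch a b hab hab').toFun v)) l
      - hit (edgeColor c v (σ.toFun v)) l) = 2 * gain c σ a b l := by
    rw [← Finset.sum_subset (Finset.subset_univ {a, b, σ.toFun a, σ.toFun b})]
    · rw [Finset.sum_insert, Finset.sum_insert, Finset.sum_insert, Finset.sum_singleton]
      · have e1 : (σ.switch a b hab hab').toFun a = b := by simp [Pairing.switch]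
        have e2 : (σ.switch a b hab hab').toFun b = a := by simp [Pairing.switch, hab]
        have e3 : (σ.switch a b hab hab').toFun (σ.toFun a) = σ.toFun b := by
          simp [Pairing.switch, ha, hab'.symm]
        have e4 : (σ.switch a b hab hab').toFun (σ.toFun b) = σ.toFun a := by
          simp [Pairing.switch, hb, hba, hσ.symm]
        rw [e1, e2, e3, e4, σ.invol, σ.invol, edgeColor_comm c b a,
          edgeColor_comm c (σ.toFun b) (σ.toFun a), edgeColor_comm c (σ.toFun a) a,
          edgeColor_comm c (σ.toFun b) b, gain, added, removed]
        ring
      all_goals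
        simp only [Finset.mem_insert, Finset.mem_singleton, not_or]
        grind
    · intro v _ hv
      simp only [Finset.mem_insert, Finset.mem_singleton, not_or] at hv
      simp [Pairing.switch, hv]
  rw [Finset.sum_sub_distrib, h1, h2] at key
  unfold dev
  linarith

theorem numColor_eq {n : ℕ} (hV : Fintype.card V = 6 * n)
    {c : SimpleGraph.TopEdgeLabeling V (Fin 3)} (hc : IsColorBalanced c) (l : Fin 3) :
    (numColor c l : ℤ) = n * (6 * n - 1) := by
  have h : ∑ l, ∑ u, ∑ v, (if v ≠ u then hit (edgeColor c u v) l else 0)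
      = ∑ l, 2 * (numColor c l : ℤ) := Finset.sum_congr rfl fun l _ => sum_hit_numColor c l
  have h' : ∑ l, ∑ u, ∑ v, (if v ≠ u then hit (edgeColor c u v) l else 0)
      = (6 * n : ℤ) * (6 * n - 1) := by
    rw [Finset.sum_comm]
    have : ∀ u : V, ∑ l, ∑ v, (if v ≠ u then hit (edgeColor c u v) l else 0) = 6 * n - 1 := by
      intro u
      rw [Finset.sum_comm]
      have h3 : ∀ v, ∑ l, (if v ≠ u then hit (edgeColor c u v) l else 0) =
          1 - if v = u then 1 else 0 := by
        intro v
        by_cases huv : v = u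
        · simp [huv]
        · simp [huv, hit]
      rw [Finset.sum_congr rfl fun v _ => h3 v]
      simp [hV]
    rw [Finset.sum_congr rfl fun u _ => this u]
    simp only [Finset.sum_const, Finset.card_univ, hV, nsmul_eq_mul]
    push_cast
    ring
  have h0 : numColor c 0 = numColor c l := hc 0 l
  have h1 : numColor c 1 = numColor c l := hc 1 l
  have h2 : numColor c 2 = numColor c l := hc 2 l
  rw [h'] at h
  simp only [Fin.sum_univ_three, h0, h1, h2] at h
  linarith

theorem sum_dev {n : ℕ} (hV : Fintype.card V = 6 * n) (c : SimpleGraph.TopEdgeLabeling V (Fin 3))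
    (σ : Pairing V) {i j k : Fin 3} (hij : i ≠ j) (hjk : j ≠ k) (hik : i ≠ k) :
    dev c n σ i + dev c n σ j + dev c n σ k = 0 := by
  have h : ∑ v, (hit (edgeColor c v (σ.toFun v)) i + hit (edgeColor c v (σ.toFun v)) j
      + hit (edgeColor c v (σ.toFun v)) k) = 6 * n := by
    simp [hit_add_hit_add_hit hij hjk hik, hV]
  rw [Finset.sum_add_distrib, Finset.sum_add_distrib, sum_hit_numColorIn, sum_hit_numColorIn,
    sum_hit_numColorIn] at h
  unfold dev
  linarith

/-- The total gain over all switches is a negative multiple of the deviation. -/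
theorem sum_gain {n : ℕ} (hV : Fintype.card V = 6 * n)
    {c : SimpleGraph.TopEdgeLabeling V (Fin 3)} (hc : IsColorBalanced c) (σ : Pairing V)
    (l : Fin 3) :
    ∑ a, ∑ b, (if b ≠ a then gain c σ a b l else 0) = -4 * (6 * n - 1) * dev c n σ l := by
  have hN := sum_hit_numColorIn c σ l
  have hT := sum_hit_numColor c l
  rw [numColor_eq hV hc l] at hT
  let e : V ≃ V := ⟨σ.toFun, σ.toFun, σ.invol, σ.invol⟩
  -- Since `σ` is a bijection, `(σ a, σ b)` also runs over all ordered pairs of distinct vertices.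
  have hT' : ∑ a, ∑ b, (if b ≠ a then hit (edgeColor c (σ.toFun a) (σ.toFun b)) l else 0)
      = 2 * (n * (6 * n - 1)) := by
    rw [← hT, ← Equiv.sum_comp e]
    refine Finset.sum_congr rfl fun a _ => ?_
    rw [← Equiv.sum_comp e]
    refine Finset.sum_congr rfl fun b _ => ?_
    simp only [e, Equiv.coe_fn_mk, ne_eq, σ.injective.eq_iff, σ.invol]
  have h3 : ∑ a : V, ∑ b : V, (if b ≠ a then hit (edgeColor c a (σ.toFun a)) l else 0)
      = (6 * n - 1) * (2 * (numColorIn c σ.subgraph l : ℤ)) := by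
    rw [← hN, Finset.mul_sum]
    refine Finset.sum_congr rfl fun a _ => ?_
    have : ∀ b : V, (if b ≠ a then hit (edgeColor c a (σ.toFun a)) l else 0) =
        hit (edgeColor c a (σ.toFun a)) l
          - (if b = a then hit (edgeColor c a (σ.toFun a)) l else 0) := by
      intro b
      by_cases h : b = a <;> simp [h]
    simp only [this, Finset.sum_sub_distrib, Finset.sum_const, Finset.card_univ, hV,
      Finset.sum_ite_eq', Finset.mem_univ, if_true]
    push_cast [nsmul_eq_mul]
    ring
  have h4 : ∑ a : V, ∑ b : V, (if b ≠ a then hit (edgeColor c b (σ.toFun b)) l else 0)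
      = (6 * n - 1) * (2 * (numColorIn c σ.subgraph l : ℤ)) := by
    rw [Finset.sum_comm, ← h3]
    simp only [ne_comm]
  have hsplit : ∀ a b : V, (if b ≠ a then gain c σ a b l else 0) =
      (if b ≠ a then hit (edgeColor c a b) l else 0)
      + (if b ≠ a then hit (edgeColor c (σ.toFun a) (σ.toFun b)) l else 0)
      - (if b ≠ a then hit (edgeColor c a (σ.toFun a)) l else 0)
      - (if b ≠ a then hit (edgeColor c b (σ.toFun b)) l else 0) := by
    intro a b
    by_cases h : b = a
    · simp [h]
    · simp only [ne_eq, h, not_false_eq_true, if_true, gain, added, removed]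
      ring
  simp only [hsplit, Finset.sum_sub_distrib, Finset.sum_add_distrib, hT, hT', h3, h4]
  unfold dev
  ring

/-- If a linear functional is positive at the deviation, then some switch decreases it. -/
theorem exists_gain_neg {n : ℕ} (hn : 0 < n) (hV : Fintype.card V = 6 * n)
    {c : SimpleGraph.TopEdgeLabeling V (Fin 3)} (hc : IsColorBalanced c) (σ : Pairing V)
    (i j k : Fin 3) (p q r : ℤ) (h : 0 < p * dev c n σ i + q * dev c n σ j + r * dev c n σ k) :
    ∃ a b, b ≠ a ∧ b ≠ σ.toFun a ∧
      p * gain c σ a b i + q * gain c σ a b j + r * gain c σ a b k < 0 := by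
  by_contra! hcon
  have hnonneg : 0 ≤ ∑ a, ∑ b, (if b ≠ a then
      p * gain c σ a b i + q * gain c σ a b j + r * gain c σ a b k else 0) := by
    refine Finset.sum_nonneg fun a _ => Finset.sum_nonneg fun b _ => ?_
    split_ifs with hab
    -- The pairs `b = σ a` enter the average but give no switch; their gain is zero.
    · by_cases hab' : b = σ.toFun a
      · subst hab'
        simp [gain, added, removed, σ.invol, edgeColor_comm c (σ.toFun a) a]
      · exact hcon a b hab hab'
    · rfl
  have hsplit : ∀ a b : V, (if b ≠ a then
      p * gain c σ a b i + q * gain c σ a b j + r * gain c σ a b k else 0) =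
      p * (if b ≠ a then gain c σ a b i else 0) + q * (if b ≠ a then gain c σ a b j else 0)
      + r * (if b ≠ a then gain c σ a b k else 0) := by
    intro a b
    by_cases h : b = a <;> simp [h]
  simp only [hsplit, Finset.sum_add_distrib, ← Finset.mul_sum, sum_gain hV hc] at hnonneg
  have hn' : (1 : ℤ) ≤ n := by exact_mod_cast hn
  nlinarith

end Counting

/-! ### Excluding every deviation shape with `t ≥ 2` -/

section Exchange

variable {V : Type*}

/-- Every perfect matching has a color whose deviation is at least `t` in absolute value. -/
def DevAtLeast [DecidableEq V] (c : SimpleGraph.TopEdgeLabeling V (Fin 3)) (n : ℕ) (t : ℤ) : Prop :=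
  ∀ σ : Pairing V, ∃ l, t ≤ |dev c n σ l|

theorem DevAtLeast.cases [DecidableEq V] {c : SimpleGraph.TopEdgeLabeling V (Fin 3)} {n : ℕ} {t : ℤ}
    (h : DevAtLeast c n t) (σ : Pairing V) {i j k : Fin 3} (hij : i ≠ j) (hjk : j ≠ k)
    (hik : i ≠ k) :
    t ≤ dev c n σ i ∨ dev c n σ i ≤ -t ∨ t ≤ dev c n σ j ∨ dev c n σ j ≤ -t ∨
      t ≤ dev c n σ k ∨ dev c n σ k ≤ -t := by
  obtain ⟨l, hl⟩ := h σ
  have hcases : l = i ∨ l = j ∨ l = k := by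
    clear hl
    revert i j k l
    decide
  rw [le_abs'] at hl
  rcases hcases with rfl | rfl | rfl <;> tauto

variable [Fintype V] [DecidableEq V]

theorem DevAtLeast.cases_switch {c : SimpleGraph.TopEdgeLabeling V (Fin 3)} {n : ℕ} {t : ℤ}
    (h : DevAtLeast c n t) (σ : Pairing V) {a b : V} (hab : b ≠ a) (hab' : b ≠ σ.toFun a)
    {i j k : Fin 3} (hij : i ≠ j) (hjk : j ≠ k) (hik : i ≠ k) :
    t ≤ dev c n σ i + gain c σ a b i ∨ dev c n σ i + gain c σ a b i ≤ -t ∨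
      t ≤ dev c n σ j + gain c σ a b j ∨ dev c n σ j + gain c σ a b j ≤ -t ∨
      t ≤ dev c n σ k + gain c σ a b k ∨ dev c n σ k + gain c σ a b k ≤ -t := by
  simpa only [dev_switch] using h.cases (σ.switch a b hab hab') hij hjk hik

section Extremal

variable {n : ℕ} {c : SimpleGraph.TopEdgeLabeling V (Fin 3)} {t : ℤ}

/-- If a matching of deviation `(t - 1, 1, -t)` had a switch leading to `(t, -1, -t + 1)`, then
no switch of it could decrease the difference of the deviations of the colors `i` and `k`. -/
theorem false_of_switch_near_corner (hn : 0 < n) (hV : Fintype.card V = 6 * n)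
    (hc : IsColorBalanced c) (ht : 2 ≤ t) (hmin : DevAtLeast c n t) (σ : Pairing V)
    {i j k : Fin 3} (hij : i ≠ j) (hjk : j ≠ k) (hik : i ≠ k)
    (hi : dev c n σ i = t - 1) (hj : dev c n σ j = 1) (hk : dev c n σ k = -t)
    {a b : V} (hab : b ≠ a) (hab' : b ≠ σ.toFun a)
    (ha : edgeColor c a (σ.toFun a) = j) (hb : edgeColor c b (σ.toFun b) = j)
    (hi' : edgeColor c a b = i) (hk' : edgeColor c (σ.toFun a) (σ.toFun b) = k) : False := by
  set τ := σ.switch a b hab hab' with hτ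
  have hgain : gain c σ a b i = 1 ∧ gain c σ a b j = -2 ∧ gain c σ a b k = 1 := by
    simp [gain, added, removed, ha, hb, hi', hk', hit, hij, hjk, hik, hij.symm, hjk.symm, hik.symm]
  have hτi : dev c n τ i = t := by rw [hτ, dev_switch]; omega
  have hτj : dev c n τ j = -1 := by rw [hτ, dev_switch]; omega
  have hτk : dev c n τ k = -t + 1 := by rw [hτ, dev_switch]; omega
  clear hgain
  have hτab : τ.toFun a = b := by simp [hτ, Pairing.switch]
  have hτba : τ.toFun b = a := by rw [τ.eq_iff, hτab]
  have hτne : ∀ v, v ≠ a → v ≠ b → v ≠ σ.toFun a → v ≠ σ.toFun b → τ.toFun v = σ.toFun v :=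
    fun v h1 h2 h3 h4 => Pairing.switch_apply_of_ne σ hab hab' h1 h2 h3 h4
  have hcolor : ∀ v, (v = a ∨ v = b ∨ v = σ.toFun a ∨ v = σ.toFun b) →
      edgeColor c v (σ.toFun v) = j := by
    rintro v (h | h | h | h) <;> rw [h]
    · exact ha
    · exact hb
    · rw [σ.invol, edgeColor_comm, ha]
    · rw [σ.invol, edgeColor_comm, hb]
  -- At `τ`, both `ab` and the pair of `q` have color `i`. Switching them removes two edges of color
  -- `i`, and unless both new edges have color `i` again, all deviations drop below `t`.
  have hclique : ∀ y q, (y = a ∨ y = b) → edgeColor c q (σ.toFun q) = i → edgeColor c y q = i := by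
    intro y q hy hq
    have hq' : ¬ (q = a ∨ q = b ∨ q = σ.toFun a ∨ q = σ.toFun b) := fun h =>
      hij (hq.symm.trans (hcolor q h))
    simp only [not_or] at hq'
    have hτq := hτne q hq'.1 hq'.2.1 hq'.2.2.1 hq'.2.2.2
    have hyq : q ≠ y := by rcases hy with h | h <;> rw [h] <;> tauto
    have hyq' : q ≠ τ.toFun y := by
      rcases hy with h | h <;> rw [h]
      · rw [hτab]; tauto
      · rw [hτba]; tauto
    have hycol : edgeColor c y (τ.toFun y) = i := by
      rcases hy with h | h <;> rw [h]
      · rw [hτab, hi']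
      · rw [hτba, edgeColor_comm, hi']
    have hrem : removed c τ y q i = 2 := by
      rw [removed, hτq, hq, hycol, hit_self]; rfl
    have hfar := hmin.cases_switch τ hyq hyq' hij hjk hik
    have hbd := added_removed_bounds c τ y q hij hjk hik
    unfold gain at hfar
    have hadd : added c τ y q i = 2 := by omega
    exact (eq_of_hit_add_hit_eq_two hadd).1
  -- Such a switch must remove an edge of color `i` at `p` and add none, but one of its new edges
  -- joins `a` or `b` to that edge, contradicting `hclique`.
  have hmeet : ∀ x p, (x = a ∨ x = b ∨ x = σ.toFun a ∨ x = σ.toFun b) → p ≠ x → p ≠ σ.toFun x →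
      gain c σ x p i < gain c σ x p k → False := by
    clear hτi hτj hτk
    intro x p hx hxp hxp' hlt
    have hfar := hmin.cases_switch σ hxp hxp' hij hjk hik
    have hbd := added_removed_bounds c σ x p hij hjk hik
    have hxi : hit (edgeColor c x (σ.toFun x)) i = 0 := by
      rw [hcolor x hx]; simp [hit, hij.symm]
    have hri : removed c σ x p i = hit (edgeColor c p (σ.toFun p)) i := by
      rw [removed, hxi, zero_add]
    have hpi := hit_eq_zero_or_one (edgeColor c p (σ.toFun p)) i
    unfold gain at hfar hlt
    have hadd : added c σ x p i = 0 := by omega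
    have hpcol : edgeColor c p (σ.toFun p) = i := eq_of_hit_pos (by omega)
    have hpcol' : edgeColor c (σ.toFun p) (σ.toFun (σ.toFun p)) = i := by
      rw [σ.invol, edgeColor_comm, hpcol]
    have h1 := hit_nonneg (edgeColor c x p) i
    have h2 := hit_nonneg (edgeColor c (σ.toFun x) (σ.toFun p)) i
    rw [added] at hadd
    have hcases : (x = a ∨ x = b) ∨ (σ.toFun x = a ∨ σ.toFun x = b) := by
      rw [σ.eq_iff, σ.eq_iff]; tauto
    rcases hcases with h | h
    · rw [hclique x p h hpcol, hit_self] at hadd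
      omega
    · rw [hclique _ _ h hpcol', hit_self] at hadd
      omega
  obtain ⟨x, p, hxp, hxp', hneg⟩ := exists_gain_neg hn hV hc σ i j k 1 0 (-1) (by omega)
  by_cases hx : x = a ∨ x = b ∨ x = σ.toFun a ∨ x = σ.toFun b
  · exact hmeet x p hx hxp hxp' (by omega)
  by_cases hp : p = a ∨ p = b ∨ p = σ.toFun a ∨ p = σ.toFun b
  · refine hmeet p x hp hxp.symm (fun h => hxp' (by rw [h, σ.invol])) ?_
    rw [gain_comm c σ p x, gain_comm c σ p x]
    omega
  -- The switch is now available at both `σ` and `τ`. Minimality at `σ` forces it to turn only color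
  -- `i` into color `j`, and this brings every deviation at `τ` below `t`.
  simp only [not_or] at hx hp
  have hτx := hτne x hx.1 hx.2.1 hx.2.2.1 hx.2.2.2
  have hτp := hτne p hp.1 hp.2.1 hp.2.2.1 hp.2.2.2
  have hfar := hmin.cases_switch σ hxp hxp' hij hjk hik
  have hfar' := hmin.cases_switch τ hxp (by rw [hτx]; exact hxp') hij hjk hik
  simp only [gain_congr c hτx hτp] at hfar'
  have hbd := added_removed_bounds c σ x p hij hjk hik
  unfold gain at hfar hfar' hneg
  omega

/-- The deviation `(t - 1, 1, -t)` is impossible if `t` is the least possible largest deviation. -/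
theorem not_dev_near_corner (hn : 0 < n) (hV : Fintype.card V = 6 * n)
    (hc : IsColorBalanced c) (ht : 2 ≤ t) (hmin : DevAtLeast c n t) (σ : Pairing V)
    {i j k : Fin 3} (hij : i ≠ j) (hjk : j ≠ k) (hik : i ≠ k)
    (hi : dev c n σ i = t - 1) (hj : dev c n σ j = 1) (hk : dev c n σ k = -t) : False := by
  obtain ⟨a, b, hab, hab', hneg⟩ := exists_gain_neg hn hV hc σ i j k 0 0 (-1) (by omega)
  have hba : σ.toFun b ≠ σ.toFun a := fun h => hab (σ.injective h)
  have hba' : σ.toFun b ≠ σ.toFun (σ.toFun a) := fun h => hab' (σ.injective h)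
  have hcore : ∀ i j : Fin 3, i ≠ j → j ≠ k → i ≠ k → dev c n σ i = t - 1 → dev c n σ j = 1 →
      removed c σ a b j = 2 → added c σ a b i = 1 → added c σ a b k = 1 → False := by
    intro i j hij hjk hik hi hj hr hai hak
    obtain ⟨ha, hb⟩ := eq_of_hit_add_hit_eq_two hr
    have h1 := hit_eq_zero_or_one (edgeColor c a b) i
    have h2 := hit_eq_zero_or_one (edgeColor c a b) k
    have h3 := hit_add_hit_add_hit hij hjk hik (edgeColor c a b)
    have h3' := hit_add_hit_add_hit hij hjk hik (edgeColor c (σ.toFun a) (σ.toFun b))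
    have h4 := hit_nonneg (edgeColor c a b) j
    have h4' := hit_nonneg (edgeColor c (σ.toFun a) (σ.toFun b)) j
    rw [added] at hai hak
    -- Either new edge may be the one of color `i`; replacing `(a, b)` by `(σ a, σ b)` exchanges
    -- them.
    rcases h1 with h1 | h1
    · refine false_of_switch_near_corner hn hV hc ht hmin σ hij hjk hik hi hj hk hba hba'
        ?_ ?_ (eq_of_hit_pos (by omega)) ?_
      · rw [σ.invol, edgeColor_comm, ha]
      · rw [σ.invol, edgeColor_comm, hb]
      · rw [σ.invol, σ.invol]
        have h5 := hit_add_hit_add_hit hij hjk hik (edgeColor c a b)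
        have h6 := hit_nonneg (edgeColor c (σ.toFun a) (σ.toFun b)) k
        have h7 := hit_eq_zero_or_one (edgeColor c (σ.toFun a) (σ.toFun b)) i
        exact eq_of_hit_pos (by omega)
    · have h6 := hit_nonneg (edgeColor c a b) k
      exact false_of_switch_near_corner hn hV hc ht hmin σ hij hjk hik hi hj hk hab hab' ha hb
        (eq_of_hit_pos (by omega)) (eq_of_hit_pos (by omega))
  have hfar := hmin.cases_switch σ hab hab' hij hjk hik
  have hbd := added_removed_bounds c σ a b hij hjk hik
  unfold gain at hfar hneg
  by_cases hr : removed c σ a b j = 2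
  · exact hcore i j hij hjk hik hi hj hr (by omega) (by omega)
  -- Here color `j` must reach `t`, which forces `t = 2`, so `i` and `j` play symmetric roles.
  · exact hcore j i hij.symm hik hjk (by omega) (by omega) (by omega) (by omega) (by omega)

/-- A switch that raises color `k` adds at most one edge to the color that must reach `t`, so that
color already stood at `t - 1`: this is the near-corner shape. -/
theorem not_dev_two_pos (hn : 0 < n) (hV : Fintype.card V = 6 * n)
    (hc : IsColorBalanced c) (ht : 2 ≤ t) (hmin : DevAtLeast c n t) (σ : Pairing V)
    {i j k : Fin 3} (hij : i ≠ j) (hjk : j ≠ k) (hik : i ≠ k)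
    (hi : 1 ≤ dev c n σ i) (hj : 1 ≤ dev c n σ j) (hk : dev c n σ k = -t) : False := by
  have hsum := sum_dev hV c σ hij hjk hik
  obtain ⟨a, b, hab, hab', hneg⟩ := exists_gain_neg hn hV hc σ i j k 0 0 (-1) (by omega)
  have hfar := hmin.cases_switch σ hab hab' hij hjk hik
  have hbd := added_removed_bounds c σ a b hij hjk hik
  unfold gain at hfar hneg
  by_cases h : dev c n σ j = 1
  · exact not_dev_near_corner hn hV hc ht hmin σ hij hjk hik (by omega) h hk
  · exact not_dev_near_corner hn hV hc ht hmin σ hij.symm hik hjk (by omega) (by omega) hk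

/-- A switch lowering color `i` must push another color to `-t`; this uses both removed edges, so
the third color gains two and the shape of `not_dev_two_pos` results. -/
theorem not_dev_two_neg (hn : 0 < n) (hV : Fintype.card V = 6 * n)
    (hc : IsColorBalanced c) (ht : 2 ≤ t) (hmin : DevAtLeast c n t) (σ : Pairing V)
    {i j k : Fin 3} (hij : i ≠ j) (hjk : j ≠ k) (hik : i ≠ k)
    (hi : dev c n σ i = t) (hj : dev c n σ j ≤ -1) (hk : dev c n σ k ≤ -1) : False := by
  have hsum := sum_dev hV c σ hij hjk hik
  obtain ⟨a, b, hab, hab', hneg⟩ := exists_gain_neg hn hV hc σ i j k 1 0 0 (by omega)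
  have hfar := hmin.cases_switch σ hab hab' hij hjk hik
  have hbd := added_removed_bounds c σ a b hij hjk hik
  have hi' := dev_switch c n σ a b hab hab' i
  have hj' := dev_switch c n σ a b hab hab' j
  have hk' := dev_switch c n σ a b hab hab' k
  unfold gain at hfar hneg hi' hj' hk'
  by_cases h : dev c n (σ.switch a b hab hab') k = -t
  · exact not_dev_two_pos hn hV hc ht hmin (σ.switch a b hab hab') hij hjk hik (by omega) (by omega) h
  · exact not_dev_two_pos hn hV hc ht hmin (σ.switch a b hab hab') hik hjk.symm hij (by omega)
      (by omega) (by omega)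

/-- Two switches on pairs of different colors can be performed one after the other. -/
theorem DevAtLeast.cases_switch_switch (hmin : DevAtLeast c n t) (σ : Pairing V) {a b x p : V}
    (hab : b ≠ a) (hab' : b ≠ σ.toFun a) (hxp : p ≠ x) (hxp' : p ≠ σ.toFun x)
    {i j k : Fin 3} (hij : i ≠ j) (hjk : j ≠ k) (hik : i ≠ k) {l : Fin 3}
    (hr : removed c σ a b l = 2) (hr' : removed c σ x p l = 0) :
    t ≤ dev c n σ i + gain c σ a b i + gain c σ x p i ∨
      dev c n σ i + gain c σ a b i + gain c σ x p i ≤ -t ∨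
      t ≤ dev c n σ j + gain c σ a b j + gain c σ x p j ∨
      dev c n σ j + gain c σ a b j + gain c σ x p j ≤ -t ∨
      t ≤ dev c n σ k + gain c σ a b k + gain c σ x p k ∨
      dev c n σ k + gain c σ a b k + gain c σ x p k ≤ -t := by
  obtain ⟨ha, hb⟩ := eq_of_hit_add_hit_eq_two hr
  rw [removed] at hr'
  have hx := hit_nonneg (edgeColor c x (σ.toFun x)) l
  have hp := hit_nonneg (edgeColor c p (σ.toFun p)) l
  have hsame : ∀ v, hit (edgeColor c v (σ.toFun v)) l = 0 →
      (σ.switch a b hab hab').toFun v = σ.toFun v := by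
    intro v hv
    have hv' : edgeColor c v (σ.toFun v) ≠ l := fun h => by simp [h, hit] at hv
    refine Pairing.switch_apply_of_ne σ hab hab' ?_ ?_ ?_ ?_ <;> intro h <;> apply hv' <;> rw [h]
    · exact ha
    · exact hb
    · rw [σ.invol, edgeColor_comm, ha]
    · rw [σ.invol, edgeColor_comm, hb]
  have hx' := hsame x (by omega)
  have hp' := hsame p (by omega)
  have h := hmin.cases_switch (σ.switch a b hab hab') hxp (by rwa [hx']) hij hjk hik
  simpa only [gain_congr c hx' hp', dev_switch] using h

/-- The deviation `(t, 0, -t)` is impossible if `t` is the least possible largest deviation. -/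
theorem not_dev_corner (hn : 0 < n) (hV : Fintype.card V = 6 * n)
    (hc : IsColorBalanced c) (ht : 2 ≤ t) (hmin : DevAtLeast c n t) (σ : Pairing V)
    {i j k : Fin 3} (hij : i ≠ j) (hjk : j ≠ k) (hik : i ≠ k)
    (hi : dev c n σ i = t) (hj : dev c n σ j = 0) (hk : dev c n σ k = -t) : False := by
  have hstep : ∀ a b, b ≠ a → b ≠ σ.toFun a →
      ¬ (1 ≤ dev c n σ i + gain c σ a b i ∧ 1 ≤ dev c n σ j + gain c σ a b j ∧
        dev c n σ k + gain c σ a b k = -t) ∧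
      ¬ (dev c n σ i + gain c σ a b i = t ∧ dev c n σ j + gain c σ a b j ≤ -1 ∧
        dev c n σ k + gain c σ a b k ≤ -1) := by
    intro a b hab hab'
    simp only [← dev_switch c n σ a b hab hab']
    exact ⟨fun h => not_dev_two_pos hn hV hc ht hmin _ hij hjk hik h.1 h.2.1 h.2.2,
      fun h => not_dev_two_neg hn hV hc ht hmin _ hij hjk hik h.1 h.2.1 h.2.2⟩
  obtain ⟨a, b, hab, hab', hneg⟩ := exists_gain_neg hn hV hc σ i j k 1 0 (-1) (by omega)
  have hfar := hmin.cases_switch σ hab hab' hij hjk hik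
  have hbd := added_removed_bounds c σ a b hij hjk hik
  have hst := hstep a b hab hab'
  -- The excluded shapes leave only `t = 2` and the gain `(-2, 2, 0)` here, or `(0, -2, 2)` in the
  -- other case. A second switch then has opposite gain in color `j` and touches different pairs;
  -- performing both brings all deviations to at most 1.
  by_cases hr : removed c σ a b i = 2
  · obtain ⟨x, p, hxp, hxp', hneg'⟩ := exists_gain_neg hn hV hc σ i j k 0 0 (-1) (by omega)
    have hfar' := hmin.cases_switch σ hxp hxp' hij hjk hik
    have hbd' := added_removed_bounds c σ x p hij hjk hik
    have hst' := hstep x p hxp hxp'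
    clear hstep
    unfold gain at hst hst' hfar hfar' hneg hneg'
    have hadd : t = 2 ∧ added c σ a b j = 2 := by
      clear hst' hfar' hneg' hbd'
      omega
    have hr' : removed c σ x p j = 2 := by
      clear hst hfar hneg hbd
      omega
    have hadd' : 1 ≤ added c σ x p k := by
      clear hst hst' hfar hfar' hneg hbd
      omega
    have hadd2 : added c σ x p j = 0 := by
      clear hst hfar hneg hbd
      omega
    have hfar2 := hmin.cases_switch_switch σ hab hab' hxp hxp' hij hjk hik hr (by omega)
    unfold gain at hfar2
    clear hst hst' hfar hfar'
    omega
  · obtain ⟨x, p, hxp, hxp', hneg'⟩ := exists_gain_neg hn hV hc σ i j k 1 0 0 (by omega)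
    have hfar' := hmin.cases_switch σ hxp hxp' hij hjk hik
    have hbd' := added_removed_bounds c σ x p hij hjk hik
    have hst' := hstep x p hxp hxp'
    clear hstep
    unfold gain at hst hst' hfar hfar' hneg hneg'
    have hrem : t = 2 ∧ removed c σ a b j = 2 ∧ added c σ a b k = 2 := by
      clear hst' hfar' hneg' hbd'
      omega
    have hadd' : added c σ x p j = 2 := by
      clear hst hfar hneg hbd
      omega
    have hr' : removed c σ x p j = 0 := by
      clear hst hfar hneg hbd
      omega
    have hfar2 := hmin.cases_switch_switch σ hab hab' hxp hxp' hij hjk hik hrem.2.1 hr'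
    unfold gain at hfar2
    clear hst hst' hfar hfar'
    omega

/-- A matching whose largest deviation is minimal has all deviations at most one. -/
theorem lt_two_of_devAtLeast (hn : 0 < n) (hV : Fintype.card V = 6 * n)
    (hc : IsColorBalanced c) (hmin : DevAtLeast c n t) (σ : Pairing V)
    (hσ : ∀ l, |dev c n σ l| ≤ t) : t < 2 := by
  by_contra! ht
  have key : ∀ i j k : Fin 3, i ≠ j → j ≠ k → i ≠ k → |dev c n σ i| = t → False := by
    intro i j k hij hjk hik hi
    have hsum := sum_dev hV c σ hij hjk hik
    have hj := abs_le.mp (hσ j)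
    have hk := abs_le.mp (hσ k)
    rcases eq_or_eq_neg_of_abs_eq hi with h | h
    · by_cases hj0 : dev c n σ j = 0
      · exact not_dev_corner hn hV hc ht hmin σ hij hjk hik h hj0 (by omega)
      by_cases hk0 : dev c n σ k = 0
      · exact not_dev_corner hn hV hc ht hmin σ hik hjk.symm hij h hk0 (by omega)
      exact not_dev_two_neg hn hV hc ht hmin σ hij hjk hik h (by omega) (by omega)
    · by_cases hj0 : dev c n σ j = 0
      · exact not_dev_corner hn hV hc ht hmin σ hjk.symm hij.symm hik.symm (by omega) hj0 h
      by_cases hk0 : dev c n σ k = 0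
      · exact not_dev_corner hn hV hc ht hmin σ hjk hik.symm hij.symm (by omega) hk0 h
      exact not_dev_two_pos hn hV hc ht hmin σ hjk hik.symm hij.symm (by omega) (by omega) h
  obtain ⟨l, hl⟩ := hmin σ
  have hl' := le_antisymm (hσ l) hl
  obtain ⟨j, k, h1, h2, h3⟩ : ∃ j k : Fin 3, l ≠ j ∧ j ≠ k ∧ l ≠ k := by
    clear hl hl'
    revert l
    decide
  exact key l j k h1 h2 h3 hl'

end Extremal

end Exchange

end ColorBalanced

open ColorBalanced in
theorem theorem2 (n : ℕ) (hn : 0 < n)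
    (c : SimpleGraph.TopEdgeLabeling (Fin (6 * n)) (Fin 3))
    (hc : ColorBalanced.IsColorBalanced c) :
    ∃ M : (⊤ : SimpleGraph (Fin (6 * n))).Subgraph,
      M.IsPerfectMatching ∧ ColorBalanced.deviation c n M ≤ 2 := by
  have hV : Fintype.card (Fin (6 * n)) = 6 * n := Fintype.card_fin _
  -- Reversal has no fixed point because `6 * n` is even; it only shows that a matching exists.
  let σ₀ : Pairing (Fin (6 * n)) := ⟨Fin.rev, Fin.rev_rev, fun v h => by
    have := congrArg Fin.val h
    rw [Fin.val_rev] at this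
    omega⟩
  let φ : Pairing (Fin (6 * n)) → ℕ := fun σ => Finset.univ.sup fun l => (dev c n σ l).natAbs
  obtain ⟨σ, -, hσ⟩ := (measure φ).wf.has_min Set.univ ⟨σ₀, trivial⟩
  have hle : ∀ l, |dev c n σ l| ≤ (φ σ : ℤ) := fun l => by
    rw [Int.abs_eq_natAbs]
    exact_mod_cast Finset.le_sup (f := fun l => (dev c n σ l).natAbs) (Finset.mem_univ l)
  have hmin : DevAtLeast c n (φ σ : ℤ) := fun τ => by
    obtain ⟨l, -, hl⟩ := Finset.exists_mem_eq_sup Finset.univ Finset.univ_nonempty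
      fun l => (dev c n τ l).natAbs
    refine ⟨l, ?_⟩
    rw [Int.abs_eq_natAbs]
    have h : φ σ ≤ φ τ := not_lt.mp (hσ τ trivial)
    exact_mod_cast h.trans_eq hl
  have hlt := lt_two_of_devAtLeast hn hV hc hmin σ hle
  refine ⟨σ.subgraph, σ.isPerfectMatching_subgraph, ?_⟩
  have hsum := sum_dev hV c σ (i := 0) (j := 1) (k := 2) (by decide) (by decide) (by decide)
  have hdev : deviation c n σ.subgraph = |dev c n σ 0| + |dev c n σ 1| + |dev c n σ 2| := by
    simp only [deviation, Fin.sum_univ_three, dev]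
  rw [hdev]
  have h0 := hle 0
  have h1 := hle 1
  have h2 := hle 2
  rw [abs_le] at h0 h1 h2
  -- Three integers in `[-1, 1]` with sum zero cannot all be nonzero.
  rcases abs_cases (dev c n σ 0) with h | h <;> rcases abs_cases (dev c n σ 1) with h' | h' <;>
    rcases abs_cases (dev c n σ 2) with h'' | h'' <;> omega
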